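/- Let $d\ge 2$. For $\theta=(\theta_1,\dots,\theta_d)\in(\mathbb{R}/2\pi\mathbb{Z})^d$ let $|\theta\rangle=\frac{1}{\sqrt d}\sum_{k=1}^d e^{i\theta_k}|k\rangle\in\mathbb{C}^d$, let $-\theta=(-\theta_1,\dots,-\theta_d)$, and let $\mathcal{D}_{\mathrm{phase}}$ be the set of the states $|\theta\rangle\langle\theta|$. Let $\mu$ be the normalized Haar measure on the torus $(\mathbb{R}/2\pi\mathbb{Z})^d$, and let $F(\rho,\sigma)=\bigl(\operatorname{tr}\sqrt{\sqrt\rho\,\sigma\sqrt\rho}\bigr)^2$ be the fidelity of density operators. Let $\mathcal{E}_{\mathrm{ideal}}:B(\mathbb{C}^d)\to B(\mathbb{C}^d\otimes\mathbb{C}^d)$ be any map (not necessarily linear) that acts on $\mathcal{D}_{\mathrm{phase}}$ as the phase-covariant transposition cloner, $$\mathcal{E}_{\mathrm{ideal}}\bigl(|\theta\rangle\langle\theta|\bigr)=|{-\theta}\rangle\langle{-\theta}|\otimes|{-\theta}\rangle\langle{-\theta}|\qquad\text{for all }\theta .$$ For a quantum channel (completely positive trace-preserving linear map) $\mathcal{E}:B(\mathbb{C}^d)\to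 B(\mathbb{C}^d\otimes\mathbb{C}^d)$ define the process fidelity $$F_{\mathrm{proc}}(\mathcal{E}_{\mathrm{ideal}},\mathcal{E}\,|\,\mathcal{D}_{\mathrm{phase}})=\int F\bigl(\mathcal{E}_{\mathrm{ideal}}(|\theta\rangle\langle\theta|),\,\mathcal{E}(|\theta\rangle\langle\theta|)\bigr)\,d\mu(\theta).$$ Then this integrand is integrable for every channel $\mathcal{E}$, the maximum of the process fidelity over all such channels exists, and $$F^*_{\mathrm{proc}}(\mathcal{E}_{\mathrm{ideal}}\,|\,\mathcal{D}_{\mathrm{phase}})=\max_{\mathcal{E}}F_{\mathrm{proc}}(\mathcal{E}_{\mathrm{ideal}},\mathcal{E}\,|\,\mathcal{D}_{\mathrm{phase}})=\begin{cases}3/4,&d=2,\\ 6/d^2,&d\ge 3.\end{cases}$$ -/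

import Mathlib

namespace QuantumCloning

noncomputable section

open scoped MatrixOrder Matrix.Norms.L2Operator CStarAlgebra Kronecker

/-- Operators on `ℂ^n`, written in the standard basis. -/
abbrev Op (n : Type) : Type := Matrix n n ℂ

/-- A quantum channel from `B(ℂ^m)` to `B(ℂ^n)`: a completely positive, trace-preserving
linear map. The order on matrices is the Loewner order. -/
structure Channel (m n : Type) [Fintype m] [DecidableEq m] [Fintype n] [DecidableEq n]
    extends Op m →CP Op n where
  trace_preserving : ∀ X : Op m, (toFun X).trace = X.trace

/-- The fidelity `F(ρ, σ) = (tr √(√ρ σ √ρ))²` of two density operators. -/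
def fidelity {n : Type} [Fintype n] [DecidableEq n] (ρ σ : Op n) : ℝ :=
  ((CFC.sqrt (CFC.sqrt ρ * σ * CFC.sqrt ρ)).trace.re) ^ 2

/-- The angles `θ ∈ ℝ/2πℤ`. -/
abbrev Angle : Type := AddCircle (2 * Real.pi)

instance fact_two_pi_pos : Fact ((0 : ℝ) < 2 * Real.pi) := ⟨Real.two_pi_pos⟩

/-- The torus of `d`-tuples of angles; this is the compact group that acts, through the diagonal
unitaries `U(θ) = ∑ₖ e^{iθₖ} |k⟩⟨k|`, on the phase states. -/
abbrev Torus (d : ℕ) : Type := Fin d → Angle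

/-- The normalized Haar measure on the torus. -/
def torusHaar (d : ℕ) : MeasureTheory.Measure (Torus d) :=
  MeasureTheory.Measure.pi fun _ => AddCircle.haarAddCircle

/-- The maximally coherent vector `|θ⟩ = d^{-1/2} ∑ₖ e^{iθₖ} |k⟩`. -/
def phaseKet {d : ℕ} (θ : Torus d) : Fin d → ℂ :=
  fun k => ((1 / Real.sqrt d : ℝ) : ℂ) * ((θ k).toCircle : ℂ)

/-- The pure state `|θ⟩⟨θ|`. -/
def phaseState {d : ℕ} (θ : Torus d) : Op (Fin d) :=
  Matrix.vecMulVec (phaseKet θ) (star (phaseKet θ))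

/-- The integrand of the process fidelity on phase states: the fidelity, at the input `|θ⟩⟨θ|`,
of the output of the ideal map with the output of the channel. The ideal map is an arbitrary
function. -/
def outputFidelity {d : ℕ} {n : Type} [Fintype n] [DecidableEq n]
    (ideal : Op (Fin d) → Op n) (E : Channel (Fin d) n) (θ : Torus d) : ℝ :=
  fidelity (ideal (phaseState θ)) (E.toFun (phaseState θ))

/-- The process fidelity of `ideal` and `E` on the set of phase states: the average of the output
fidelity over the phase states, with respect to the measure induced by the Haar measure of the
torus. -/
def processFidelity {d : ℕ} {n : Type} [Fintype n] [DecidableEq n]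
    (ideal : Op (Fin d) → Op n) (E : Channel (Fin d) n) : ℝ :=
  ∫ θ, outputFidelity ideal E θ ∂(torusHaar d)

/-- `F` is the optimal process fidelity of `ideal` on the set of phase states: the process fidelity
with every channel is well defined, and `F` is the maximum of its values over all channels. -/
def IsOptimalProcessFidelity {d : ℕ} {n : Type} [Fintype n] [DecidableEq n]
    (ideal : Op (Fin d) → Op n) (F : ℝ) : Prop :=
  (∀ E : Channel (Fin d) n, MeasureTheory.Integrable (outputFidelity ideal E) (torusHaar d)) ∧
    IsGreatest (Set.range fun E : Channel (Fin d) n => processFidelity ideal E) F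

/-- `ideal` acts on the phase states as the `1 → 2` transposition cloner,
`|θ⟩⟨θ| ↦ |-θ⟩⟨-θ| ⊗ |-θ⟩⟨-θ|`. -/
def IsTranspositionCloner {d : ℕ} (ideal : Op (Fin d) → Op (Fin d × Fin d)) : Prop :=
  ∀ θ : Torus d, ideal (phaseState θ) = phaseState (-θ) ⊗ₖ phaseState (-θ)

end

end QuantumCloning

/-!
A channel `E` enters through its Choi matrix `J`, with entries `⟨p| E(|i⟩⟨j|) |q⟩` at
`((i, p), (j, q))`, where `p` and `q` are pairs of output indices. As the ideal output is pure, the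
fidelity is the overlap of `E(|θ⟩⟨θ|)` with it (`fidelity_pure`), a quadratic form in `J` whose
coefficients are characters of the torus. The ideal output is conjugated, so the phases of an index
triple `(i, a, b)` add up to `θᵢ + θₐ + θ_b`, and averaging over the torus keeps the entries
`J x y` with `x` and `y` orderings of the same multiset (`processFidelity_eq`):
the process fidelity is `d⁻³` times the sum of these entries.

Complete positivity makes `J` positive semidefinite (`Channel.exists_choi_factor`), so `Re J x y` is
at most `(J x x + J y y) / 2`, and the sum is at most `∑ₓ N(x) J x x`, where `N(x)` is the number of
orderings of `x`. With `K = max N` and `tr J = d` the process fidelity is at most `K / d²`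
(`sum_choi_le`). A multiset of three elements has at most six orderings, and at most three if there
are only two values to choose from; this is the origin of the two cases.

Equality holds for a `J` that is a constant block on each multiset with `K` orderings and zero
elsewhere. It is trace preserving, up to normalization: `{i, a, b} = {j, a, b}` forces `i = j`, and
the number of pairs `(a, b)` that complete `i` to a multiset with `K` orderings is independent of
`i` by permutation symmetry (`numExtensions_eq`). The channel itself is built from Kraus operators
(`exists_channel_sum_choi_eq`).
-/

namespace QuantumCloning

open scoped MatrixOrder Matrix.Norms.L2Operator CStarAlgebra Kronecker
open scoped ComplexOrder
open MeasureTheory Matrix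

noncomputable section

/-! ### Channels: Choi matrices and Kraus operators -/

/-- A positive element of a C⋆-algebra is of the form `b⋆ b`. For matrices over a C⋆-algebra the
instances that `CStarAlgebra.nonneg_iff_eq_star_mul_self` asks for are found only through this
version, which takes the C⋆-algebra structure as a whole. -/
theorem exists_star_mul_self_eq {A : Type} [NonUnitalCStarAlgebra A] [PartialOrder A]
    [StarOrderedRing A] {a : A} (ha : 0 ≤ a) : ∃ b, a = star b * b :=
  CStarAlgebra.nonneg_iff_eq_star_mul_self.1 ha

section Channels

variable {m n : Type} [Fintype m] [DecidableEq m] [Fintype n] [DecidableEq n]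

/-- The Choi matrix of a channel is positive semidefinite, stated as the existence of a
factorization. -/
theorem Channel.exists_choi_factor (E : Channel m n) :
    ∃ w : m × n → m × n → ℂ, ∀ i j p q,
      E.toFun (Matrix.single i j 1) p q = ∑ k, star (w k (i, p)) * w k (j, q) := by
  classical
  cases isEmpty_or_nonempty m with
  | inl h => exact ⟨fun _ _ => 0, fun i => h.elim i⟩
  | inr h =>
  obtain ⟨o⟩ := h
  -- `U⋆ U` is the block matrix with `|i⟩⟨j|` at `(i, j)`, to which complete positivity is applied.
  let U : CStarMatrix m m (Op m) :=
    CStarMatrix.ofMatrix fun k j => if k = o then Matrix.single o j 1 else 0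
  have hU : ∀ i j, (star U * U) i j = Matrix.single i j 1 := by
    intro i j
    have hUk : ∀ k j, U k j = if k = o then Matrix.single o j 1 else 0 := fun _ _ => rfl
    rw [CStarMatrix.mul_apply, Finset.sum_eq_single o]
    · simp [hUk, CStarMatrix.star_apply, Matrix.star_eq_conjTranspose]
    · intro k _ hk
      simp [hUk, hk]
    · simp
  have hpos := CompletelyPositiveMap.map_cstarMatrix_nonneg E.toCompletelyPositiveMap _
    (star_mul_self_nonneg U)
  obtain ⟨B, hB⟩ := exists_star_mul_self_eq hpos
  refine ⟨fun k x => B k.1 x.1 k.2 x.2, fun i j p q => ?_⟩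
  have h1 := congrArg (fun M : CStarMatrix m m (Op n) => M i j) hB
  simp only [CStarMatrix.map_apply, hU, CStarMatrix.mul_apply] at h1
  have h2 : E.toFun (Matrix.single i j 1) = ∑ k, star B i k * B k j := h1
  rw [h2, Matrix.sum_apply, Fintype.sum_prod_type]
  refine Finset.sum_congr rfl fun k _ => ?_
  rw [Matrix.mul_apply]
  rfl

theorem Channel.toFun_apply (E : Channel m n) (X : Op m) (p q : n) :
    E.toFun X p q = ∑ i, ∑ j, X i j * E.toFun (Matrix.single i j 1) p q := by
  conv_lhs => rw [Matrix.matrix_eq_sum_single X]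
  have h : ∀ i j, Matrix.single i j (X i j) = X i j • Matrix.single i j (1 : ℂ) := by simp
  have h2 : ∀ X : Op m, E.toFun X = E.toLinearMap X := fun _ => rfl
  simp only [h, h2, map_sum, map_smul, Matrix.sum_apply, Matrix.smul_apply, smul_eq_mul]

/-- The channel `X ↦ ∑ V X V⋆` with Kraus operators `V`. The isometry `S` only serves to prove
complete positivity: it embeds the input space in the output space, so that the rectangular blocks
`N V⋆` can be replaced by the square blocks `S N V⋆`, elements of the output algebra. -/
def krausChannel {ι : Type} [Fintype ι] (S : Matrix n m ℂ) (hS : Sᴴ * S = 1)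
    (V : ι → Matrix n m ℂ) (hV : ∑ z, (V z)ᴴ * V z = 1) : Channel m n where
  toFun X := ∑ z, V z * X * (V z)ᴴ
  map_add' X Y := by simp [Matrix.mul_add, Matrix.add_mul, Finset.sum_add_distrib]
  map_smul' c X := by simp [Finset.smul_sum]
  map_cstarMatrix_nonneg' k M hM := by
    obtain ⟨N, rfl⟩ := exists_star_mul_self_eq hM
    let B : ι → CStarMatrix (Fin k) (Fin k) (Op n) := fun z =>
      CStarMatrix.ofMatrix fun r i => S * N r i * (V z)ᴴ
    have hB : (star N * N).map (fun X : Op m => ∑ z, V z * X * (V z)ᴴ) =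
        ∑ z, star (B z) * B z := by
      have hsum : ∀ i j, (∑ z, star (B z) * B z) i j = ∑ z, (star (B z) * B z) i j := by
        intro i j
        exact Matrix.sum_apply i j Finset.univ _
      ext1 i j
      rw [hsum, CStarMatrix.map_apply]
      refine Finset.sum_congr rfl fun z _ => ?_
      rw [CStarMatrix.mul_apply, CStarMatrix.mul_apply, Matrix.mul_sum, Matrix.sum_mul]
      refine Finset.sum_congr rfl fun r _ => ?_
      have e1 : star (B z) i r = (S * N r i * (V z)ᴴ)ᴴ := rfl
      have e2 : B z r j = S * N r j * (V z)ᴴ := rfl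
      have e3 : star N i r = (N r i)ᴴ := rfl
      rw [e1, e2, e3]
      simp only [Matrix.conjTranspose_mul, Matrix.conjTranspose_conjTranspose, Matrix.mul_assoc]
      rw [← Matrix.mul_assoc Sᴴ S, hS, Matrix.one_mul]
    change 0 ≤ (star N * N).map (fun X : Op m => ∑ z, V z * X * (V z)ᴴ)
    rw [hB]
    exact Finset.sum_nonneg fun z _ => star_mul_self_nonneg (B z)
  trace_preserving X := by
    change (∑ z, V z * X * (V z)ᴴ).trace = X.trace
    rw [Matrix.trace_sum]
    have h : ∀ z, (V z * X * (V z)ᴴ).trace = ((V z)ᴴ * V z * X).trace := fun z => by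
      rw [Matrix.trace_mul_comm, Matrix.mul_assoc]
    simp only [h]
    rw [← Matrix.trace_sum, ← Matrix.sum_mul, hV, Matrix.one_mul]

theorem krausChannel_single {ι : Type} [Fintype ι] (S : Matrix n m ℂ) (hS : Sᴴ * S = 1)
    (V : ι → Matrix n m ℂ) (hV : ∑ z, (V z)ᴴ * V z = 1) (i j : m) (p q : n) :
    (krausChannel S hS V hV).toFun (Matrix.single i j 1) p q =
      ∑ z, V z p i * star (V z q j) := by
  change (∑ z, V z * Matrix.single i j (1 : ℂ) * (V z)ᴴ : Op n) p q = _
  rw [Matrix.sum_apply]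
  refine Finset.sum_congr rfl fun z _ => ?_
  simp [Matrix.mul_apply, Matrix.single_apply, Finset.sum_ite_eq, ite_and]

end Channels

/-! ### Fidelity with a pure state -/

/-- The fidelity of a pure state with `σ` is the overlap `⟨φ|σ|φ⟩`. Only this overlap, and not `σ`,
has to be nonnegative, since `√ρ σ √ρ = ⟨φ|σ|φ⟩ ρ` for `ρ = |φ⟩⟨φ|`. -/
theorem fidelity_pure {n : Type} [Fintype n] [DecidableEq n] (φ : n → ℂ) (σ : Op n)
    (hφ : star φ ⬝ᵥ φ = 1) (hσ : 0 ≤ star φ ⬝ᵥ (σ *ᵥ φ)) :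
    fidelity (vecMulVec φ (star φ)) σ = (star φ ⬝ᵥ (σ *ᵥ φ)).re := by
  set P : Op n := vecMulVec φ (star φ) with hP
  have hP0 : 0 ≤ P := (Matrix.posSemidef_vecMulVec_self_star φ).nonneg
  have hPP : P * P = P := by
    rw [hP, Matrix.vecMulVec_mul_vecMulVec, hφ]; simp
  have hs : CFC.sqrt P = P := CFC.sqrt_unique hPP hP0
  obtain ⟨hre, him⟩ := Complex.nonneg_iff.1 hσ
  set s := (star φ ⬝ᵥ (σ *ᵥ φ)).re with hsdef
  have hsc : star φ ⬝ᵥ (σ *ᵥ φ) = (s : ℂ) := by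
    apply Complex.ext <;> simp [hsdef, ← him]
  have hPσ : P * σ * P = (s : ℂ) • P := by
    rw [Matrix.mul_assoc, hP, Matrix.mul_vecMulVec, Matrix.vecMulVec_mul_vecMulVec, hsc]
    ext i j
    simp [Matrix.vecMulVec_apply]
    ring
  have hsq : CFC.sqrt (P * σ * P) = ((Real.sqrt s : ℝ) : ℂ) • P := by
    refine CFC.sqrt_unique ?_ ?_
    · rw [hPσ, Matrix.smul_mul, Matrix.mul_smul, hPP, smul_smul, ← Complex.ofReal_mul,
        Real.mul_self_sqrt hre]
    · exact smul_nonneg (by exact_mod_cast Real.sqrt_nonneg s) hP0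
  have htr : P.trace = 1 := by
    rw [hP, Matrix.trace_vecMulVec, dotProduct_comm, hφ]
  rw [fidelity, hs, hsq, Matrix.trace_smul, htr]
  simp [Real.sq_sqrt hre]

/-! ### Characters of the torus -/

section Torus

variable {d : ℕ}

instance : IsProbabilityMeasure (torusHaar d) := by
  unfold torusHaar; infer_instance

/-- The character `θ ↦ exp (i ∑ₖ cₖ θₖ)` of the torus. -/
def torusChar (c : Fin d → ℤ) (θ : Torus d) : ℂ := ∏ k, fourier (c k) (θ k)

theorem continuous_torusChar (c : Fin d → ℤ) : Continuous (torusChar c) := by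
  unfold torusChar
  fun_prop

theorem torusChar_add (c c' : Fin d → ℤ) (θ : Torus d) :
    torusChar (c + c') θ = torusChar c θ * torusChar c' θ := by
  simp [torusChar, Finset.prod_mul_distrib]

theorem torusChar_neg (c : Fin d → ℤ) (θ : Torus d) :
    torusChar (-c) θ = star (torusChar c θ) := by
  simp [torusChar]

theorem torusChar_single (i : Fin d) (θ : Torus d) :
    torusChar (Pi.single i 1) θ = ((θ i).toCircle : ℂ) := by
  rw [torusChar, Finset.prod_eq_single i]
  · simp
  · intro k _ hk
    simp [hk]
  · simp

theorem integral_torusChar (c : Fin d → ℤ) :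
    ∫ θ, torusChar c θ ∂(torusHaar d) = if c = 0 then 1 else 0 := by
  have h1 : ∀ n : ℤ, ∫ t : Angle, fourier n t ∂AddCircle.haarAddCircle =
      if n = 0 then 1 else 0 := by
    intro n
    have := congrFun (fourierCoeff_fourier (T := 2 * Real.pi) n) 0
    simpa [fourierCoeff, Pi.single_apply, eq_comm] using this
  unfold torusChar torusHaar
  rw [integral_fintype_prod_eq_prod (f := fun k (t : Angle) => (fourier (c k) t : ℂ))]
  simp only [h1]
  rw [Finset.prod_ite_zero]
  simp [funext_iff]

theorem integrable_torusChar (c : Fin d → ℤ) : Integrable (torusChar c) (torusHaar d) :=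
  (continuous_torusChar c).integrable_of_hasCompactSupport
    (HasCompactSupport.of_compactSpace _)

end Torus

/-! ### The process fidelity in terms of the Choi matrix -/

section ProcessFidelity

variable {d : ℕ}

/-- The multiplicity function of the multiset `{i, a, b}`, for an input index `i` and a pair
`(a, b)` of output indices. -/
def multiplicity (x : Fin d × Fin d × Fin d) : Fin d → ℤ :=
  Pi.single x.1 1 + Pi.single x.2.1 1 + Pi.single x.2.2 1

/-- The Choi matrix of a channel, with entries `⟨p| E(|i⟩⟨j|) |q⟩` at `((i, p), (j, q))`. -/
def choi {m n : Type} [Fintype m] [DecidableEq m] [Fintype n] [DecidableEq n]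
    (E : Channel m n) (x y : m × n) : ℂ :=
  E.toFun (Matrix.single x.1 y.1 1) x.2 y.2

/-- The vector `|-θ⟩ ⊗ |-θ⟩`. -/
def doubleKet (θ : Torus d) (p : Fin d × Fin d) : ℂ :=
  phaseKet (-θ) p.1 * phaseKet (-θ) p.2

theorem phaseState_kronecker (θ : Torus d) :
    phaseState (-θ) ⊗ₖ phaseState (-θ) = vecMulVec (doubleKet θ) (star (doubleKet θ)) := by
  ext p q
  simp [phaseState, doubleKet, Matrix.vecMulVec_apply]
  ring

theorem ofReal_inv_sqrt_mul_self (d : ℕ) :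
    ((1 / Real.sqrt d : ℝ) : ℂ) * ((1 / Real.sqrt d : ℝ) : ℂ) = 1 / d := by
  rw [← Complex.ofReal_mul, div_mul_div_comm, Real.mul_self_sqrt (Nat.cast_nonneg d)]
  push_cast
  ring

theorem star_phaseKet_mul_self (θ : Torus d) (k : Fin d) :
    star (phaseKet θ k) * phaseKet θ k = 1 / d := by
  have h1 : ((θ k).toCircle : ℂ) * star ((θ k).toCircle : ℂ) = 1 := by
    rw [Complex.star_def, Complex.mul_conj]; simp
  have h2 : star (((1 / Real.sqrt d : ℝ) : ℂ)) = ((1 / Real.sqrt d : ℝ) : ℂ) :=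
    Complex.conj_ofReal _
  rw [phaseKet, star_mul', ← ofReal_inv_sqrt_mul_self, h2]
  linear_combination (((1 / Real.sqrt d : ℝ) : ℂ) * ((1 / Real.sqrt d : ℝ) : ℂ)) * h1

theorem star_phaseKet_neg (θ : Torus d) (k : Fin d) :
    star (phaseKet (-θ) k) = phaseKet θ k := by
  have h : star (((1 / Real.sqrt d : ℝ) : ℂ)) = ((1 / Real.sqrt d : ℝ) : ℂ) :=
    Complex.conj_ofReal _
  rw [phaseKet, phaseKet, star_mul', h]
  simp [AddCircle.toCircle_neg, Circle.coe_inv_eq_conj, -Circle.coe_inv]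

theorem star_doubleKet_dotProduct_self (hd : d ≠ 0) (θ : Torus d) :
    star (doubleKet θ) ⬝ᵥ doubleKet θ = 1 := by
  have hd' : (d : ℂ) ≠ 0 := by exact_mod_cast hd
  have h : ∀ p : Fin d × Fin d, star (doubleKet θ p) * doubleKet θ p = 1 / d * (1 / d) := by
    intro p
    rw [doubleKet, star_mul', mul_mul_mul_comm, star_phaseKet_mul_self, star_phaseKet_mul_self]
  simp only [dotProduct, Pi.star_apply, h]
  simp [Fintype.card_prod]
  field_simp

/-- As the output is conjugated, all three indices enter the amplitude with a phase of the same
sign; this is why only their multiset matters. -/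
theorem phaseKet_mul_star_doubleKet (θ : Torus d) (x : Fin d × Fin d × Fin d) :
    phaseKet θ x.1 * star (doubleKet θ x.2) =
      ((1 / Real.sqrt d : ℝ) : ℂ) ^ 3 * torusChar (multiplicity x) θ := by
  rw [doubleKet, star_mul', star_phaseKet_neg, star_phaseKet_neg, multiplicity, torusChar_add,
    torusChar_add]
  simp only [torusChar_single, phaseKet]
  ring

/-- The overlap of the output with the ideal output, as a quadratic form in the Choi matrix. -/
theorem overlap_eq_sum (E : Channel (Fin d) (Fin d × Fin d)) (θ : Torus d) :
    star (doubleKet θ) ⬝ᵥ (E.toFun (phaseState θ) *ᵥ doubleKet θ) =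
      ∑ x, ∑ y, (phaseKet θ x.1 * star (doubleKet θ x.2)) *
        star (phaseKet θ y.1 * star (doubleKet θ y.2)) * choi E x y := by
  rw [Fintype.sum_prod_type_right]
  simp only [dotProduct, Matrix.mulVec, Pi.star_apply, E.toFun_apply (phaseState θ)]
  refine Finset.sum_congr rfl fun p _ => ?_
  rw [Finset.mul_sum]
  have h : ∀ i, (∑ y : Fin d × Fin d × Fin d, (phaseKet θ i * star (doubleKet θ p)) *
      star (phaseKet θ y.1 * star (doubleKet θ y.2)) * choi E (i, p) y) =
      ∑ q, ∑ j, (phaseKet θ i * star (doubleKet θ p)) *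
      star (phaseKet θ j * star (doubleKet θ q)) * choi E (i, p) (j, q) :=
    fun i => Fintype.sum_prod_type_right _
  simp only [h]
  rw [Finset.sum_comm]
  refine Finset.sum_congr rfl fun q _ => ?_
  rw [Finset.sum_mul, Finset.mul_sum]
  refine Finset.sum_congr rfl fun i _ => ?_
  rw [Finset.sum_mul, Finset.mul_sum]
  refine Finset.sum_congr rfl fun j _ => ?_
  simp only [phaseState, Matrix.vecMulVec_apply, Pi.star_apply, choi, star_mul', star_star]
  ring

theorem overlap_eq_torusChar (E : Channel (Fin d) (Fin d × Fin d)) (θ : Torus d) :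
    star (doubleKet θ) ⬝ᵥ (E.toFun (phaseState θ) *ᵥ doubleKet θ) =
      (1 / (d : ℂ) ^ 3) * ∑ x, ∑ y,
        torusChar (multiplicity x - multiplicity y) θ * choi E x y := by
  have hr : ((1 / Real.sqrt d : ℝ) : ℂ) ^ 3 * ((1 / Real.sqrt d : ℝ) : ℂ) ^ 3 =
      1 / (d : ℂ) ^ 3 := by
    rw [← mul_pow, ofReal_inv_sqrt_mul_self, div_pow, one_pow]
  have hs : star (((1 / Real.sqrt d : ℝ) : ℂ)) = ((1 / Real.sqrt d : ℝ) : ℂ) :=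
    Complex.conj_ofReal _
  rw [overlap_eq_sum, Finset.mul_sum]
  refine Finset.sum_congr rfl fun x _ => ?_
  rw [Finset.mul_sum]
  refine Finset.sum_congr rfl fun y _ => ?_
  rw [phaseKet_mul_star_doubleKet, phaseKet_mul_star_doubleKet, sub_eq_add_neg, torusChar_add,
    torusChar_neg, ← hr, star_mul', star_pow, hs]
  ring

/-- A factorization `J = ∑ₖ w̄ₖ wₖ` of the Choi matrix turns the overlap into a sum of squares. -/
theorem overlap_nonneg (E : Channel (Fin d) (Fin d × Fin d)) (θ : Torus d) :
    0 ≤ star (doubleKet θ) ⬝ᵥ (E.toFun (phaseState θ) *ᵥ doubleKet θ) := by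
  obtain ⟨w, hw⟩ := E.exists_choi_factor
  set v : Fin d × Fin d × Fin d → ℂ := fun x => phaseKet θ x.1 * star (doubleKet θ x.2) with hv
  have h : star (doubleKet θ) ⬝ᵥ (E.toFun (phaseState θ) *ᵥ doubleKet θ) =
      ∑ k, star (∑ y, star (v y) * w k y) * ∑ y, star (v y) * w k y := by
    rw [overlap_eq_sum]
    simp only [choi, hw, star_sum, Finset.sum_mul_sum]
    conv_rhs => rw [Finset.sum_comm]
    refine Finset.sum_congr rfl fun x _ => ?_
    rw [Finset.sum_comm]
    refine Finset.sum_congr rfl fun y _ => ?_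
    rw [Finset.mul_sum]
    refine Finset.sum_congr rfl fun k _ => ?_
    simp only [hv, star_mul', star_star]
    ring
  rw [h]
  exact Finset.sum_nonneg fun k _ => star_mul_self_nonneg _

theorem outputFidelity_eq (hd : d ≠ 0) {ideal : Op (Fin d) → Op (Fin d × Fin d)}
    (hideal : IsTranspositionCloner ideal) (E : Channel (Fin d) (Fin d × Fin d)) (θ : Torus d) :
    outputFidelity ideal E θ = ((1 / (d : ℂ) ^ 3) * ∑ x, ∑ y,
        torusChar (multiplicity x - multiplicity y) θ * choi E x y).re := by
  rw [outputFidelity, hideal, phaseState_kronecker,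
    fidelity_pure _ _ (star_doubleKet_dotProduct_self hd θ) (overlap_nonneg E θ),
    overlap_eq_torusChar]

theorem integrable_overlap (E : Channel (Fin d) (Fin d × Fin d)) :
    Integrable (fun θ => (1 / (d : ℂ) ^ 3) * ∑ x, ∑ y,
        torusChar (multiplicity x - multiplicity y) θ * choi E x y) (torusHaar d) :=
  (integrable_finsetSum _ fun _ _ => integrable_finsetSum _ fun _ _ =>
    (integrable_torusChar _).mul_const _).const_mul _

theorem integrable_outputFidelity (hd : d ≠ 0) {ideal : Op (Fin d) → Op (Fin d × Fin d)}
    (hideal : IsTranspositionCloner ideal) (E : Channel (Fin d) (Fin d × Fin d)) :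
    Integrable (outputFidelity ideal E) (torusHaar d) := by
  rw [funext (outputFidelity_eq hd hideal E)]
  exact (integrable_overlap E).re

/-- Averaging over the torus keeps the Choi entries between orderings of the same multiset. -/
theorem processFidelity_eq (hd : d ≠ 0) {ideal : Op (Fin d) → Op (Fin d × Fin d)}
    (hideal : IsTranspositionCloner ideal) (E : Channel (Fin d) (Fin d × Fin d)) :
    processFidelity ideal E = (1 / (d : ℝ) ^ 3) *
      ∑ x, ∑ y, if multiplicity x = multiplicity y then (choi E x y).re else 0 := by
  have h : processFidelity ideal E = (∫ θ, (1 / (d : ℂ) ^ 3) * ∑ x, ∑ y,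
        torusChar (multiplicity x - multiplicity y) θ * choi E x y ∂(torusHaar d)).re := by
    rw [processFidelity, funext (outputFidelity_eq hd hideal E)]
    exact integral_re (integrable_overlap E)
  have hc : (1 / (d : ℂ) ^ 3) = ((1 / (d : ℝ) ^ 3 : ℝ) : ℂ) := by push_cast; rfl
  rw [h, integral_const_mul, integral_finsetSum _ fun x _ => integrable_finsetSum _ fun y _ =>
    (integrable_torusChar _).mul_const _, hc, Complex.re_ofReal_mul, Complex.re_sum]
  congr 1
  refine Finset.sum_congr rfl fun x _ => ?_
  rw [integral_finsetSum _ fun y _ => (integrable_torusChar _).mul_const _, Complex.re_sum]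
  refine Finset.sum_congr rfl fun y _ => ?_
  rw [integral_mul_const, integral_torusChar]
  simp only [sub_eq_zero]
  split_ifs <;> simp

end ProcessFidelity

/-! ### Orderings of multisets of three indices -/

section Classes

variable {d : ℕ}

/-- The number of orderings of the multiset `{i, a, b}` of an index triple `(i, a, b)`. -/
def numOrderings (x : Fin d × Fin d × Fin d) : ℕ :=
  (Finset.univ.filter fun y => multiplicity y = multiplicity x).card

/-- The largest possible number of orderings of a multiset of three elements of `Fin d`. -/
def maxOrderings (d : ℕ) : ℕ := if d = 2 then 3 else 6

/-- Triples with the same multiplicities are permutations of each other. -/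
theorem multiplicity_eq_cases {x y : Fin d × Fin d × Fin d}
    (h : multiplicity y = multiplicity x) :
    y ∈ ({(x.1, x.2.1, x.2.2), (x.1, x.2.2, x.2.1), (x.2.1, x.1, x.2.2), (x.2.1, x.2.2, x.1),
      (x.2.2, x.1, x.2.1), (x.2.2, x.2.1, x.1)} : Finset (Fin d × Fin d × Fin d)) := by
  obtain ⟨i, a, b⟩ := x
  obtain ⟨j, p, q⟩ := y
  have pair : ∀ {a b p q : Fin d},
      (Pi.single p 1 + Pi.single q 1 : Fin d → ℤ) = Pi.single a 1 + Pi.single b 1 →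
      (p = a ∧ q = b) ∨ (p = b ∧ q = a) := by
    intro a b p q h
    have := (Pi.single_add_single_eq_single_add_single (one_ne_zero' ℤ) (one_ne_zero' ℤ)).1 h
    simpa using this
  simp only [multiplicity] at h
  have hj : j = i ∨ j = a ∨ j = b := by
    by_contra! hne
    have := congrFun h j
    simp only [Pi.add_apply, Pi.single_eq_same, Pi.single_eq_of_ne hne.1,
      Pi.single_eq_of_ne hne.2.1, Pi.single_eq_of_ne hne.2.2, Pi.single_apply] at this
    split_ifs at this <;> omega
  have hpair : (j = i ∧ (p = a ∧ q = b ∨ p = b ∧ q = a)) ∨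
      (j = a ∧ (p = i ∧ q = b ∨ p = b ∧ q = i)) ∨ (j = b ∧ (p = i ∧ q = a ∨ p = a ∧ q = i)) := by
    rcases hj with rfl | rfl | rfl
    · refine Or.inl ⟨rfl, pair ?_⟩
      linear_combination h
    · refine Or.inr (Or.inl ⟨rfl, pair ?_⟩)
      linear_combination h
    · refine Or.inr (Or.inr ⟨rfl, pair ?_⟩)
      linear_combination h
  simp only [Finset.mem_insert, Finset.mem_singleton, Prod.mk.injEq]
  tauto

theorem numOrderings_le (x : Fin d × Fin d × Fin d) : numOrderings x ≤ maxOrderings d := by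
  by_cases hd : d = 2
  · subst hd
    revert x
    unfold numOrderings maxOrderings multiplicity
    decide
  · rw [maxOrderings, if_neg hd]
    refine (Finset.card_le_card fun y hy =>
      multiplicity_eq_cases (Finset.mem_filter.1 hy).2).trans Finset.card_le_six

theorem exists_numOrderings_eq (hd : 2 ≤ d) :
    ∃ x : Fin d × Fin d × Fin d, numOrderings x = maxOrderings d := by
  obtain rfl | hd3 := hd.eq_or_lt
  · refine ⟨(0, 0, 1), ?_⟩
    unfold numOrderings maxOrderings multiplicity
    decide
  · let i : Fin d := ⟨0, by omega⟩
    let a : Fin d := ⟨1, by omega⟩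
    let b : Fin d := ⟨2, by omega⟩
    have hia : i ≠ a := by simp [i, a]
    have hib : i ≠ b := by simp [i, b]
    have hab : a ≠ b := by simp [a, b]
    refine ⟨(i, a, b), (numOrderings_le _).antisymm ?_⟩
    have hcard : ({(i, a, b), (i, b, a), (a, i, b), (a, b, i), (b, i, a), (b, a, i)} :
        Finset (Fin d × Fin d × Fin d)).card = 6 := by
      simp [Finset.card_insert_of_notMem, hia, hib, hab, hia.symm, hib.symm, hab.symm]
    rw [maxOrderings, if_neg (by omega), ← hcard]
    refine Finset.card_le_card fun y hy => ?_
    simp only [Finset.mem_insert, Finset.mem_singleton] at hy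
    rw [Finset.mem_filter]
    refine ⟨Finset.mem_univ _, ?_⟩
    rcases hy with rfl | rfl | rfl | rfl | rfl | rfl <;> simp only [multiplicity] <;> abel

theorem numOrderings_congr {x y : Fin d × Fin d × Fin d} (h : multiplicity x = multiplicity y) :
    numOrderings x = numOrderings y := by
  unfold numOrderings
  rw [h]

/-- The coordinatewise action of a permutation of `Fin d` on index triples. -/
def permTriple (σ : Equiv.Perm (Fin d)) : Equiv.Perm (Fin d × Fin d × Fin d) :=
  σ.prodCongr (σ.prodCongr σ)

theorem multiplicity_permTriple (σ : Equiv.Perm (Fin d)) (x : Fin d × Fin d × Fin d) :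
    multiplicity (permTriple σ x) = multiplicity x ∘ σ.symm := by
  ext k
  simp [multiplicity, permTriple, Pi.single_apply, Equiv.symm_apply_eq]

theorem numOrderings_permTriple (σ : Equiv.Perm (Fin d)) (x : Fin d × Fin d × Fin d) :
    numOrderings (permTriple σ x) = numOrderings x := by
  symm
  refine Finset.card_equiv (permTriple σ) fun y => ?_
  simp only [Finset.mem_filter, Finset.mem_univ, true_and, multiplicity_permTriple]
  exact ((σ.symm.surjective.injective_comp_right).eq_iff).symm

/-- The number of pairs `(a, b)` for which `{i, a, b}` has the largest number of orderings. -/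
def numExtensions (i : Fin d) : ℕ :=
  (Finset.univ.filter fun p : Fin d × Fin d => numOrderings (i, p) = maxOrderings d).card

/-- The symmetric group acts transitively on `Fin d`, so `numExtensions` is constant. -/
theorem numExtensions_eq (i j : Fin d) : numExtensions i = numExtensions j := by
  refine Finset.card_equiv ((Equiv.swap i j).prodCongr (Equiv.swap i j)) fun p => ?_
  have h := numOrderings_permTriple (Equiv.swap i j) (i, p)
  simp only [permTriple, Equiv.prodCongr_apply, Prod.map, Equiv.swap_apply_left] at h
  simp [← h, Prod.map]

theorem numExtensions_pos (hd : 2 ≤ d) (i : Fin d) : 0 < numExtensions i := by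
  obtain ⟨x, hx⟩ := exists_numOrderings_eq hd
  rw [numExtensions_eq i x.1]
  exact Finset.card_pos.2 ⟨x.2, by simpa using hx⟩

end Classes

/-! ### The upper bound -/

section UpperBound

variable {d : ℕ}

/-- The trace of the Choi matrix is `d`, by trace preservation. -/
theorem sum_choi_diag (E : Channel (Fin d) (Fin d × Fin d)) :
    ∑ x, (choi E x x).re = d := by
  have h : ∀ i : Fin d, ∑ p, choi E (i, p) (i, p) = 1 := by
    intro i
    have := E.trace_preserving (Matrix.single i i 1)
    rw [Matrix.trace_single_eq_same] at this
    exact this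
  rw [Fintype.sum_prod_type]
  simp only [← Complex.re_sum, h]
  simp

/-- The real part of an off-diagonal entry is at most the mean of the two diagonal entries, since
the Choi matrix is positive semidefinite. -/
theorem choi_re_le (E : Channel (Fin d) (Fin d × Fin d)) (x y : Fin d × Fin d × Fin d) :
    (choi E x y).re ≤ ((choi E x x).re + (choi E y y).re) / 2 := by
  obtain ⟨w, hw⟩ := E.exists_choi_factor
  simp only [choi, hw, Complex.re_sum, ← Finset.sum_add_distrib, Finset.sum_div]
  refine Finset.sum_le_sum fun k _ => ?_
  simp only [Complex.star_def, Complex.mul_re, Complex.conj_re, Complex.conj_im]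
  nlinarith [sq_nonneg ((w k (x.1, x.2)).re - (w k (y.1, y.2)).re),
    sq_nonneg ((w k (x.1, x.2)).im - (w k (y.1, y.2)).im)]

theorem choi_diag_nonneg (E : Channel (Fin d) (Fin d × Fin d)) (x : Fin d × Fin d × Fin d) :
    0 ≤ (choi E x x).re := by
  obtain ⟨w, hw⟩ := E.exists_choi_factor
  simp only [choi, hw, Complex.re_sum]
  refine Finset.sum_nonneg fun k _ => ?_
  simp only [Complex.star_def, Complex.mul_re, Complex.conj_re, Complex.conj_im]
  nlinarith [sq_nonneg (w k (x.1, x.2)).re, sq_nonneg (w k (x.1, x.2)).im]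

theorem sum_ite_multiplicity (x : Fin d × Fin d × Fin d) (c : ℝ) :
    (∑ y, if multiplicity x = multiplicity y then c else 0) = numOrderings x * c := by
  rw [Finset.sum_ite, Finset.sum_const_zero, add_zero, Finset.sum_const, nsmul_eq_mul]
  simp only [numOrderings, eq_comm]

theorem sum_choi_le (E : Channel (Fin d) (Fin d × Fin d)) :
    (∑ x, ∑ y, if multiplicity x = multiplicity y then (choi E x y).re else 0) ≤
      maxOrderings d * d := by
  -- Each `x` collects the weight `(choi E x x).re / 2` twice from every ordering `y` of it.
  calc (∑ x, ∑ y, if multiplicity x = multiplicity y then (choi E x y).re else 0)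
      ≤ ∑ x, ∑ y, ((if multiplicity x = multiplicity y then (choi E x x).re / 2 else 0) +
          if multiplicity y = multiplicity x then (choi E y y).re / 2 else 0) := by
        refine Finset.sum_le_sum fun x _ => Finset.sum_le_sum fun y _ => ?_
        by_cases h : multiplicity x = multiplicity y
        · rw [if_pos h, if_pos h, if_pos h.symm]
          linarith [choi_re_le E x y]
        · rw [if_neg h, if_neg h, if_neg (Ne.symm h), add_zero]
    _ = ∑ x, numOrderings x * (choi E x x).re := by
        simp only [Finset.sum_add_distrib]
        rw [Finset.sum_comm (f := fun x y => if multiplicity y = multiplicity x then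
          (choi E y y).re / 2 else 0), ← Finset.sum_add_distrib]
        refine Finset.sum_congr rfl fun x _ => ?_
        rw [sum_ite_multiplicity]
        ring
    _ ≤ ∑ x, maxOrderings d * (choi E x x).re := by
        refine Finset.sum_le_sum fun x _ =>
          mul_le_mul_of_nonneg_right ?_ (choi_diag_nonneg E x)
        exact_mod_cast numOrderings_le x
    _ = maxOrderings d * d := by rw [← Finset.mul_sum, sum_choi_diag]

end UpperBound

/-! ### A channel that attains the bound -/

section Optimal

variable {d : ℕ}

theorem multiplicity_eq_left {i j : Fin d} {p : Fin d × Fin d}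
    (h : multiplicity (i, p) = multiplicity (j, p)) : i = j := by
  simp only [multiplicity, add_left_inj] at h
  have := congrFun h i
  by_contra hne
  simp [hne] at this

theorem maxOrderings_pos (d : ℕ) : 0 < maxOrderings d := by
  unfold maxOrderings; split_ifs <;> norm_num

/-- The Kraus operators of the optimal cloner. The operator of an index triple `z` is `α` times the
indicator of the triples `(i, p)` that are orderings of `z`; it vanishes unless `z` has the largest
number of orderings. Orderings `z` of the same multiset repeat the same operator, which only
rescales it. -/
def clonerKraus (α : ℝ) (z : Fin d × Fin d × Fin d) : Matrix (Fin d × Fin d) (Fin d) ℂ :=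
  Matrix.of fun p i =>
    if multiplicity (i, p) = multiplicity z ∧ numOrderings z = maxOrderings d then (α : ℂ) else 0

/-- The Choi matrix of the map with Kraus operators `clonerKraus α`: on each multiset with the
largest number of orderings, a constant block. -/
theorem sum_clonerKraus_mul_star (α : ℝ) (x y : Fin d × Fin d × Fin d) :
    ∑ z, clonerKraus α z x.2 x.1 * star (clonerKraus α z y.2 y.1) =
      if multiplicity x = multiplicity y ∧ numOrderings x = maxOrderings d then
        ((maxOrderings d * α ^ 2 : ℝ) : ℂ) else 0 := by
  have h : ∀ z, clonerKraus α z x.2 x.1 * star (clonerKraus α z y.2 y.1) =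
      if multiplicity x = multiplicity y ∧ numOrderings x = maxOrderings d then
        (((if multiplicity x = multiplicity z then α ^ 2 else 0 : ℝ)) : ℂ) else 0 := by
    intro z
    simp only [clonerKraus, Matrix.of_apply, Prod.mk.eta]
    by_cases hx : multiplicity x = multiplicity z
    · have hn := numOrderings_congr hx
      by_cases hy : multiplicity y = multiplicity z
      · by_cases hz : numOrderings z = maxOrderings d
        · simp [hx, hy, hz, hn, sq]
        · simp [hx, hy, hz, hn]
      · have : ¬ multiplicity z = multiplicity y := fun h => hy h.symm
        simp [hx, hy, this]
    · simp [hx]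
  simp only [h]
  split_ifs with hc
  · rw [← Complex.ofReal_sum, sum_ite_multiplicity, hc.2]
  · simp

/-- The condition `∑ V⋆ V = 1` on the Kraus operators. The off-diagonal entries vanish because
`{i, a, b} = {j, a, b}` only if `i = j`, and the diagonal entries do not depend on `i` because
`numExtensions i` does not. -/
theorem sum_clonerKraus (α : ℝ)
    (hα : ∀ i : Fin d, numExtensions i * (maxOrderings d * α ^ 2) = 1) :
    ∑ z, (clonerKraus (d := d) α z)ᴴ * clonerKraus α z = 1 := by
  ext j i
  have h : (∑ z, (clonerKraus (d := d) α z)ᴴ * clonerKraus α z) j i =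
      ∑ p, ∑ z, clonerKraus α z p i * star (clonerKraus α z p j) := by
    rw [Matrix.sum_apply, Finset.sum_comm]
    refine Finset.sum_congr rfl fun z _ => ?_
    rw [Matrix.mul_apply]
    exact Finset.sum_congr rfl fun p _ => mul_comm _ _
  have h2 := fun p => sum_clonerKraus_mul_star α (i, p) (j, p)
  simp only at h2
  rw [h]
  simp only [h2]
  by_cases hij : j = i
  · subst hij
    rw [Matrix.one_apply_eq]
    simp only [true_and]
    rw [Finset.sum_ite, Finset.sum_const_zero, add_zero, Finset.sum_const, nsmul_eq_mul]
    exact_mod_cast hα j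
  · rw [Matrix.one_apply_ne hij]
    refine Finset.sum_eq_zero fun p _ => if_neg fun hc => hij (multiplicity_eq_left hc.1).symm

/-- The isometry `|i⟩ ↦ |i⟩ ⊗ |i⟩`. -/
def diagonalIsometry (d : ℕ) : Matrix (Fin d × Fin d) (Fin d) ℂ :=
  Matrix.of fun p i => if p = (i, i) then 1 else 0

theorem diagonalIsometry_conjTranspose_mul_self :
    (diagonalIsometry d)ᴴ * diagonalIsometry d = 1 := by
  ext i j
  simp [diagonalIsometry, Matrix.mul_apply, Matrix.one_apply, eq_comm]

theorem exists_channel_sum_choi_eq (hd : 2 ≤ d) :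
    ∃ E : Channel (Fin d) (Fin d × Fin d),
      (∑ x, ∑ y, if multiplicity x = multiplicity y then (choi E x y).re else 0) =
        maxOrderings d * d := by
  let o : Fin d := ⟨0, by omega⟩
  have hN : (0 : ℝ) < numExtensions o := by exact_mod_cast numExtensions_pos hd o
  have hK : (0 : ℝ) < maxOrderings d := by exact_mod_cast maxOrderings_pos d
  set α : ℝ := Real.sqrt (1 / (numExtensions o * maxOrderings d)) with hαdef
  have hα : ∀ i : Fin d, numExtensions i * (maxOrderings d * α ^ 2) = 1 := by
    intro i
    rw [numExtensions_eq i o, hαdef, Real.sq_sqrt (by positivity)]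
    field_simp
  refine ⟨krausChannel (diagonalIsometry d) diagonalIsometry_conjTranspose_mul_self
    (clonerKraus α) (sum_clonerKraus α hα), ?_⟩
  have hchoi : ∀ x y, choi (krausChannel (diagonalIsometry d)
      diagonalIsometry_conjTranspose_mul_self (clonerKraus α) (sum_clonerKraus α hα)) x y =
      if multiplicity x = multiplicity y ∧ numOrderings x = maxOrderings d then
        ((maxOrderings d * α ^ 2 : ℝ) : ℂ) else 0 := fun x y => by
    rw [choi, krausChannel_single, sum_clonerKraus_mul_star]
  have hrow : ∀ x : Fin d × Fin d × Fin d,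
      (∑ y, if multiplicity x = multiplicity y then
        (choi (krausChannel (diagonalIsometry d) diagonalIsometry_conjTranspose_mul_self
          (clonerKraus α) (sum_clonerKraus α hα)) x y).re else 0) =
      maxOrderings d *
        if numOrderings x = maxOrderings d then maxOrderings d * α ^ 2 else 0 := by
    intro x
    by_cases hx : numOrderings x = maxOrderings d
    · rw [if_pos hx, ← hx, ← sum_ite_multiplicity]
      refine Finset.sum_congr rfl fun y _ => ?_
      rw [hchoi]
      by_cases hxy : multiplicity x = multiplicity y
      · rw [if_pos hxy, if_pos hxy, if_pos ⟨hxy, hx⟩, Complex.ofReal_re, hx]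
      · rw [if_neg hxy, if_neg hxy]
    · rw [if_neg hx, mul_zero]
      refine Finset.sum_eq_zero fun y _ => ?_
      rw [hchoi, if_neg (c := _ ∧ _) fun h => hx h.2, Complex.zero_re, ite_self]
  simp only [hrow]
  rw [← Finset.mul_sum, Fintype.sum_prod_type]
  have hin : ∀ i : Fin d, (∑ p, if numOrderings (i, p) = maxOrderings d then
      maxOrderings d * α ^ 2 else 0) = 1 := by
    intro i
    rw [Finset.sum_ite, Finset.sum_const_zero, add_zero, Finset.sum_const, nsmul_eq_mul]
    exact hα i
  simp only [hin]
  simp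

end Optimal

end

end QuantumCloning

theorem theorem2 (d : ℕ) (hd : 2 ≤ d)
    (ideal : QuantumCloning.Op (Fin d) → QuantumCloning.Op (Fin d × Fin d))
    (hideal : QuantumCloning.IsTranspositionCloner ideal) :
    QuantumCloning.IsOptimalProcessFidelity ideal
      (if d = 2 then 3 / 4 else 6 / (d : ℝ) ^ 2) := by
  have hd0 : d ≠ 0 := by omega
  have hdR : (0 : ℝ) < d := by exact_mod_cast Nat.pos_of_ne_zero hd0
  have hval : (if d = 2 then 3 / 4 else 6 / (d : ℝ) ^ 2 : ℝ) =
      (1 / (d : ℝ) ^ 3) * (QuantumCloning.maxOrderings d * d) := by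
    unfold QuantumCloning.maxOrderings
    split_ifs with h
    · subst h; norm_num
    · push_cast; field_simp
  rw [hval]
  refine ⟨QuantumCloning.integrable_outputFidelity hd0 hideal, ?_, ?_⟩
  · obtain ⟨E, hE⟩ := QuantumCloning.exists_channel_sum_choi_eq hd
    exact ⟨E, by simp only [QuantumCloning.processFidelity_eq hd0 hideal, hE]⟩
  · rintro _ ⟨E, rfl⟩
    simp only [QuantumCloning.processFidelity_eq hd0 hideal]
    exact mul_le_mul_of_nonneg_left (QuantumCloning.sum_choi_le E) (by positivity)
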